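/- Let $\mathbb T=\mathbb R/2\pi\mathbb Z$ and write $\hat u(k)=\frac1{2\pi}\int_{\mathbb T}u(\theta)e^{-ik\theta}\,d\theta$. Let $\Pi\big(\sum_{k\in\mathbb Z}v_ke^{ik\theta}\big)=\sum_{k\ge 0}v_ke^{ik\theta}$ be the Szegő projector on $L^2(\mathbb T)$. Let $H^s_+(\mathbb T)$ be the space of all $u\in L^2(\mathbb T)$ with $\hat u(k)=0$ for all $k<0$ and $\|u\|_{H^s}^2=\sum_{k\in\mathbb Z}(1+k^2)^s|\hat u(k)|^2<\infty$, and let $\|u\|_W=\sum_{k\in\mathbb Z}|\hat u(k)|$ be the Wiener norm. For every $s>1$ there is a constant $C(s)>0$, depending only on $s$, such that the following holds. Let $u_0\in H^s_+(\mathbb T)$, and let $u\in C(\mathbb R,H^s_+(\mathbb T))$ be the global solution of the cubic Szegő equation $$i\,\partial_t u=\Pi(|u|^2u),\qquad u(0)=u_0,$$ where the time derivative is taken in $L^2(\mathbb T)$. Then $u(t)\in W$, i.e. $\|u(t)\|_W<\infty$, and $$\|u(t)\|_W\le C(s)\,\|u_0\|_{H^s}\qquad\text{for all }t\in\mathbb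 R.$$ -/

import Mathlib

open MeasureTheory AddCircle Filter Topology

noncomputable section

namespace CubicSzego

/-- The positivity of the period `2π`, which makes `AddCircle (2 * Real.pi)` a compact circle. -/
instance factTwoPiPos : Fact (0 < 2 * Real.pi) := ⟨Real.two_pi_pos⟩

/-- The one-dimensional torus `𝕋 = ℝ / 2πℤ`. -/
abbrev Torus : Type := AddCircle (2 * Real.pi)

/-- The normalized Lebesgue (Haar) measure on the torus. -/
abbrev torusMeasure : Measure Torus := haarAddCircle

/-- The complex Hilbert space `L²(𝕋)`. -/
abbrev L2Torus : Type := Lp ℂ 2 torusMeasure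

/-- The Fourier coefficient `û(k) = (1/2π) ∫ u(θ) e^{-ikθ} dθ`, for `k ∈ ℤ`. -/
def coeff (u : L2Torus) (k : ℤ) : ℂ := fourierCoeff (u : Torus → ℂ) k

/-- The Hardy space `L²₊(𝕋)`: the `u ∈ L²(𝕋)` with `û(k) = 0` for all `k < 0`. -/
def hardySpace : Set L2Torus := {u | ∀ k : ℤ, k < 0 → coeff u k = 0}

/-- Setting the coefficients of negative index to zero keeps a sequence square summable. -/
theorem memlp_truncate (a : lp (fun _ : ℤ => ℂ) 2) :
    Memℓp (fun k : ℤ => if 0 ≤ k then a k else 0) 2 := by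
  refine (lp.memℓp a).mono' (fun k => ?_)
  split_ifs <;> simp

/-- The Szegő projector `Π (∑_{k ∈ ℤ} v_k e^{ikθ}) = ∑_{k ≥ 0} v_k e^{ikθ}` on `L²(𝕋)`. -/
def szegoProj (v : L2Torus) : L2Torus :=
  fourierBasis.repr.symm
    ⟨fun k : ℤ => if 0 ≤ k then fourierBasis.repr v k else 0,
      memlp_truncate (fourierBasis.repr v)⟩

/-- The Fourier coefficients of `Π v`. -/
theorem coeff_szegoProj (v : L2Torus) (k : ℤ) :
    coeff (szegoProj v) k = if 0 ≤ k then coeff v k else 0 := by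
  simp only [coeff, ← fourierBasis_repr, szegoProj, LinearIsometryEquiv.apply_symm_apply]

/-- Membership in the Sobolev space `H^s(𝕋)` (for `s ≥ 0`):
`∑_{k ∈ ℤ} (1 + k²)^s |û(k)|² < ∞`. -/
def MemSobolev (s : ℝ) (u : L2Torus) : Prop :=
  Summable fun k : ℤ => (1 + (k : ℝ) ^ 2) ^ s * ‖coeff u k‖ ^ 2

/-- The Sobolev norm `‖u‖_{H^s} = (∑_{k ∈ ℤ} (1 + k²)^s |û(k)|²)^{1/2}` (for `u ∈ H^s(𝕋)`). -/
def sobolevNorm (s : ℝ) (u : L2Torus) : ℝ :=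
  Real.sqrt (∑' k : ℤ, (1 + (k : ℝ) ^ 2) ^ s * ‖coeff u k‖ ^ 2)

/-- The space `H^s₊(𝕋) = H^s(𝕋) ∩ L²₊(𝕋)`. -/
def sobolevPlus (s : ℝ) : Set L2Torus := {u | u ∈ hardySpace ∧ MemSobolev s u}

/-- Membership in the Wiener algebra `W`: `∑_{k ∈ ℤ} |û(k)| < ∞`. -/
def MemWiener (u : L2Torus) : Prop := Summable fun k : ℤ => ‖coeff u k‖

/-- The Wiener norm `‖u‖_W = ∑_{k ∈ ℤ} |û(k)|` (for `u ∈ W`). -/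
def wienerNorm (u : L2Torus) : ℝ := ∑' k : ℤ, ‖coeff u k‖

/-- `u ∈ C(ℝ, H^s₊(𝕋))` is a global solution of the cubic Szegő equation
`i ∂ₜu = Π(|u|² u)` with initial datum `u(0) = u₀`. The time derivative is taken in `L²(𝕋)`. -/
structure IsGlobalSolution (s : ℝ) (u₀ : L2Torus) (u : ℝ → L2Torus) : Prop where
  /-- `u` takes its values in `H^s₊(𝕋)`. -/
  mem : ∀ t : ℝ, u t ∈ sobolevPlus s
  /-- `u` is continuous in time for the norm of `H^s`. -/
  continuous : ∀ t₀ : ℝ, Tendsto (fun t : ℝ => sobolevNorm s (u t - u t₀)) (𝓝 t₀) (𝓝 0)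
  /-- The initial condition. -/
  initial : u 0 = u₀
  /-- At every time `|u|² u` is in `L²(𝕋)` and the equation holds. -/
  equation : ∀ t : ℝ,
    ∃ (h : MemLp (fun θ : Torus => ((‖u t θ‖ ^ 2 : ℝ) : ℂ) * u t θ) 2 torusMeasure)
      (u' : L2Torus), HasDerivAt u u' t ∧ Complex.I • u' = szegoProj (h.toLp _)

end CubicSzego

end

/-! Attach to `u` in the Hardy space the Hankel operator H_u f = Π(u f̅), whose matrix in the
exponentials e_n, n ≥ 0, is û(m + n). Under the cubic Szegő equation H_u follows a Lax pair with
skew-adjoint generator (i/2) H_u² - i T_{|u|²}, so H_{u(t)} stays unitarily equivalent to H_{u₀} and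
its trace norm is conserved. That norm controls the Wiener norm: û(2n) and û(2n+1) are the entries
(n, n) and (n, n+1), and each of these two families is absolutely summable with sum at most the
trace norm. At time 0 the trace norm is at most ∑ ‖H_{u₀} e_k‖ ≤ ∑ (1 + k²)^{-s/2} ‖u₀‖_{H^s},
finite for s > 1.

Neither a trace norm nor a unitary propagator is constructed. The operator is replaced by the form
⟪f, b g̅⟫ on the Hardy space; `IsTransported` carries orthonormal families from one time to another,
and `sum_norm_inner_mulOp_conjOp_le` bounds the form on all such families. The algebra is
`lax_identity`. Since `u` is differentiable only in L², `IsSymbolFlow` supplies a second symbol,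
differentiable in C(𝕋), that defines the same form. -/

noncomputable section

namespace CubicSzego

open scoped ENNReal InnerProductSpace ComplexConjugate

/-! ### Multiplication, conjugation and frequency projections on `L²(𝕋)` -/

/-- Multiplication by a continuous function, as a bounded operator on `L²(𝕋)`. -/
def mulOp : C(Torus, ℂ) →L[ℂ] L2Torus →L[ℂ] L2Torus :=
  ((ContinuousLinearMap.mul ℂ ℂ).holderL torusMeasure ∞ 2 2).comp
    (ContinuousMap.toLp ∞ torusMeasure ℂ)

/-- Complex conjugation on `L²(𝕋)`. -/
def conjOp : L2Torus →L[ℝ] L2Torus :=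
  (Complex.conjCLE : ℂ →L[ℝ] ℂ).compLpL 2 torusMeasure

/-- The embedding of the continuous functions in `L²(𝕋)`. -/
def toL2 : C(Torus, ℂ) →L[ℂ] L2Torus := ContinuousMap.toLp 2 torusMeasure ℂ

/-- The exponential `e^{ikθ}` in `L²(𝕋)`. -/
def expL2 (k : ℤ) : L2Torus := toL2 (fourier k)

theorem coeFn_mulOp (b : C(Torus, ℂ)) (f : L2Torus) :
    mulOp b f =ᵐ[torusMeasure] fun x => b x * f x := by
  have h1 := (ContinuousLinearMap.mul ℂ ℂ).coeFn_holder (r := 2)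
    (ContinuousMap.toLp ∞ torusMeasure ℂ b) f
  have h2 := ContinuousMap.coeFn_toLp (p := ∞) (𝕜 := ℂ) torusMeasure b
  refine Filter.EventuallyEq.trans (show _ =ᵐ[torusMeasure] _ from h1) ?_
  filter_upwards [h2] with x hx
  rw [hx]; rfl

theorem coeFn_conjOp (f : L2Torus) : conjOp f =ᵐ[torusMeasure] fun x => conj (f x) :=
  ContinuousLinearMap.coeFn_compLpL _ f

theorem coeFn_toL2 (b : C(Torus, ℂ)) : toL2 b =ᵐ[torusMeasure] b :=
  ContinuousMap.coeFn_toLp torusMeasure b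

theorem mulOp_mul (a b : C(Torus, ℂ)) (f : L2Torus) : mulOp (a * b) f = mulOp a (mulOp b f) := by
  apply Lp.ext
  filter_upwards [coeFn_mulOp (a * b) f, coeFn_mulOp a (mulOp b f), coeFn_mulOp b f] with x h1 h2 h3
  rw [h1, h2, h3, ContinuousMap.mul_apply, mul_assoc]

theorem mulOp_toL2 (a b : C(Torus, ℂ)) : mulOp a (toL2 b) = toL2 (a * b) := by
  apply Lp.ext
  filter_upwards [coeFn_mulOp a (toL2 b), coeFn_toL2 b, coeFn_toL2 (a * b)] with x h1 h2 h3
  rw [h1, h2, h3, ContinuousMap.mul_apply]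

theorem inner_mulOp_left (a : C(Torus, ℂ)) (f g : L2Torus) :
    ⟪mulOp a f, g⟫_ℂ = ⟪f, mulOp (star a) g⟫_ℂ := by
  rw [L2.inner_def, L2.inner_def]
  apply integral_congr_ae
  filter_upwards [coeFn_mulOp a f, coeFn_mulOp (star a) g] with x h1 h2
  rw [h1, h2]
  simp only [RCLike.inner_apply, map_mul, ContinuousMap.star_apply, RCLike.star_def]
  ring

theorem conjOp_mulOp (a : C(Torus, ℂ)) (f : L2Torus) :
    conjOp (mulOp a f) = mulOp (star a) (conjOp f) := by
  apply Lp.ext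
  filter_upwards [coeFn_conjOp (mulOp a f), coeFn_mulOp a f, coeFn_mulOp (star a) (conjOp f),
    coeFn_conjOp f] with x h1 h2 h3 h4
  rw [h1, h2, h3, h4]
  simp

theorem conjOp_smul (c : ℂ) (f : L2Torus) : conjOp (c • f) = conj c • conjOp f := by
  apply Lp.ext
  filter_upwards [coeFn_conjOp (c • f), Lp.coeFn_smul c f, Lp.coeFn_smul (conj c) (conjOp f),
    coeFn_conjOp f] with x h1 h2 h3 h4
  rw [h1, h2, h3, Pi.smul_apply, Pi.smul_apply, h4]
  simp

theorem conjOp_conjOp (f : L2Torus) : conjOp (conjOp f) = f := by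
  apply Lp.ext
  filter_upwards [coeFn_conjOp (conjOp f), coeFn_conjOp f] with x h1 h2
  rw [h1, h2]
  simp

theorem inner_conjOp_conjOp (f g : L2Torus) : ⟪conjOp f, conjOp g⟫_ℂ = ⟪g, f⟫_ℂ := by
  rw [L2.inner_def, L2.inner_def]
  apply integral_congr_ae
  filter_upwards [coeFn_conjOp f, coeFn_conjOp g] with x h1 h2
  rw [h1, h2]
  simp only [RCLike.inner_apply, RCLike.conj_conj]
  ring

/-- The bilinear form `(f, g) ↦ ⟪f, b g̅⟫` is symmetric. -/
theorem inner_mulOp_conjOp_comm (b : C(Torus, ℂ)) (f g : L2Torus) :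
    ⟪f, mulOp b (conjOp g)⟫_ℂ = ⟪g, mulOp b (conjOp f)⟫_ℂ := by
  rw [← inner_conjOp_conjOp, conjOp_mulOp, conjOp_conjOp, inner_mulOp_left, star_star]

theorem conjOp_expL2 (k : ℤ) : conjOp (expL2 k) = expL2 (-k) := by
  apply Lp.ext
  filter_upwards [coeFn_conjOp (expL2 k), coeFn_toL2 (fourier k), coeFn_toL2 (fourier (-k))]
    with x h1 h2 h3
  rw [h1, expL2, expL2, h2, h3, fourier_neg]

theorem fourier_mul_fourier (j k : ℤ) : (fourier j * fourier k : C(Torus, ℂ)) = fourier (j + k) := by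
  ext x; simp

theorem star_fourier (k : ℤ) : star (fourier k : C(Torus, ℂ)) = fourier (-k) := by
  ext x; simp

/-! ### Fourier coefficients and Parseval -/

theorem coe_fourierBasis_apply (k : ℤ) : (fourierBasis k : L2Torus) = expL2 k := by
  rw [coe_fourierBasis]; rfl

theorem orthonormal_expL2 : Orthonormal ℂ expL2 := orthonormal_fourier

theorem coeff_eq_inner (f : L2Torus) (k : ℤ) : coeff f k = ⟪expL2 k, f⟫_ℂ := by
  rw [coeff, ← fourierBasis_repr, HilbertBasis.repr_apply_apply, coe_fourierBasis_apply]

theorem coeff_add (f g : L2Torus) (k : ℤ) : coeff (f + g) k = coeff f k + coeff g k := by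
  simp only [coeff_eq_inner, inner_add_right]

theorem coeff_sub (f g : L2Torus) (k : ℤ) : coeff (f - g) k = coeff f k - coeff g k := by
  simp only [coeff_eq_inner, inner_sub_right]

theorem coeff_smul (c : ℂ) (f : L2Torus) (k : ℤ) : coeff (c • f) k = c * coeff f k := by
  simp only [coeff_eq_inner, inner_smul_right]

theorem coeff_zero (k : ℤ) : coeff 0 k = 0 := by
  simp only [coeff_eq_inner, inner_zero_right]

theorem ext_coeff {f g : L2Torus} (h : ∀ k, coeff f k = coeff g k) : f = g := by
  apply fourierBasis.repr.injective
  ext k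
  rw [fourierBasis_repr, fourierBasis_repr]
  exact h k

theorem hasSum_inner_coeff (f g : L2Torus) :
    HasSum (fun k => conj (coeff f k) * coeff g k) ⟪f, g⟫_ℂ := by
  have := fourierBasis.hasSum_inner_mul_inner f g
  simpa only [coe_fourierBasis_apply, ← coeff_eq_inner, ← inner_conj_symm f] using this

theorem hasSum_norm_coeff_sq (f : L2Torus) : HasSum (fun k => ‖coeff f k‖ ^ 2) (‖f‖ ^ 2) := by
  have h := hasSum_inner_coeff f f
  rw [inner_self_eq_norm_sq_to_K] at h
  have h2 := Complex.reCLM.hasSum h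
  convert! h2 using 1
  · ext k
    simp only [Complex.reCLM_apply, RCLike.conj_mul]
    norm_cast
  · rw [Complex.reCLM_apply]
    norm_cast

theorem coeff_conjOp (f : L2Torus) (k : ℤ) : coeff (conjOp f) k = conj (coeff f (-k)) := by
  rw [coeff_eq_inner, coeff_eq_inner, inner_conj_symm, ← conjOp_expL2, ← inner_conjOp_conjOp,
    conjOp_conjOp]

theorem coeff_mulOp_expL2 (b : C(Torus, ℂ)) (k n : ℤ) :
    coeff (mulOp b (expL2 k)) n = coeff (toL2 b) (n - k) := by
  rw [coeff_eq_inner, coeff_eq_inner, expL2.eq_1 k, mulOp_toL2, mul_comm b, ← mulOp_toL2, ← neg_neg k,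
    ← star_fourier, ← inner_mulOp_left, expL2, mulOp_toL2, fourier_mul_fourier, expL2, neg_neg,
    neg_add_eq_sub]

/-- The coefficients of a product are given by a convolution. -/
theorem hasSum_coeff_mulOp (b : C(Torus, ℂ)) (f : L2Torus) (n : ℤ) :
    HasSum (fun k => coeff (toL2 b) (n - k) * coeff f k) (coeff (mulOp b f) n) := by
  -- Parseval for the pairing of b̅ e_n with `f`, after moving `b` across the inner product.
  have h := hasSum_inner_coeff (mulOp (star b) (expL2 n)) f
  rw [inner_mulOp_left, star_star, ← coeff_eq_inner] at h
  convert! h using 2 with k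
  rw [coeff_eq_inner (mulOp _ _), ← star_star b, star_star (star b), ← inner_mulOp_left,
    inner_conj_symm, star_star, ← coeff_eq_inner, coeff_mulOp_expL2]

/-- The closed subspace of the `f ∈ L²(𝕋)` with frequencies in `S`. -/
def freqSpace (S : Set ℤ) : Submodule ℂ L2Torus where
  carrier := {f | ∀ k, k ∉ S → coeff f k = 0}
  zero_mem' k _ := coeff_zero k
  add_mem' hf hg k hk := by rw [coeff_add, hf k hk, hg k hk, add_zero]
  smul_mem' c f hf k hk := by rw [coeff_smul, hf k hk, mul_zero]

theorem mem_freqSpace {S : Set ℤ} {f : L2Torus} :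
    f ∈ freqSpace S ↔ ∀ k, k ∉ S → coeff f k = 0 := Iff.rfl

theorem isClosed_freqSpace (S : Set ℤ) : IsClosed (freqSpace S : Set L2Torus) := by
  have : (freqSpace S : Set L2Torus) = ⋂ k, ⋂ (_ : k ∉ S), {f | coeff f k = 0} := by
    ext f; simp [mem_freqSpace]
  rw [this]
  refine isClosed_iInter fun k => isClosed_iInter fun _ => ?_
  simp only [coeff_eq_inner]
  exact isClosed_eq (by fun_prop) continuous_const

instance completeSpace_freqSpace (S : Set ℤ) : CompleteSpace (freqSpace S) :=
  (isClosed_freqSpace S).completeSpace_coe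

/-- The orthogonal projection of `L²(𝕋)` onto the functions with frequencies in `S`. -/
def freqProj (S : Set ℤ) : L2Torus →L[ℂ] L2Torus := (freqSpace S).starProjection

theorem expL2_mem_freqSpace {S : Set ℤ} {k : ℤ} (hk : k ∈ S) : expL2 k ∈ freqSpace S := by
  intro j hj
  rw [coeff_eq_inner, orthonormal_expL2.inner_eq_zero]
  rintro rfl
  exact hj hk

theorem inner_freqProj_left (S : Set ℤ) (f g : L2Torus) :
    ⟪freqProj S f, g⟫_ℂ = ⟪f, freqProj S g⟫_ℂ :=
  Submodule.inner_starProjection_left_eq_right _ _ _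

theorem freqProj_eq_self {S : Set ℤ} {f : L2Torus} (hf : f ∈ freqSpace S) : freqProj S f = f :=
  Submodule.starProjection_eq_self_iff.2 hf

theorem freqProj_mem (S : Set ℤ) (f : L2Torus) : freqProj S f ∈ freqSpace S :=
  Submodule.starProjection_apply_mem _ _

theorem coeff_freqProj_of_mem {S : Set ℤ} (f : L2Torus) {k : ℤ} (hk : k ∈ S) :
    coeff (freqProj S f) k = coeff f k := by
  rw [coeff_eq_inner, ← inner_freqProj_left, freqProj_eq_self (expL2_mem_freqSpace hk),
    coeff_eq_inner]

theorem coeff_freqProj_of_notMem {S : Set ℤ} (f : L2Torus) {k : ℤ} (hk : k ∉ S) :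
    coeff (freqProj S f) k = 0 := freqProj_mem S f k hk

theorem szegoProj_eq_freqProj (f : L2Torus) : szegoProj f = freqProj (Set.Ici 0) f := by
  refine ext_coeff fun k => ?_
  rw [coeff_szegoProj]
  split_ifs with hk
  · exact (coeff_freqProj_of_mem (S := Set.Ici 0) f hk).symm
  · exact (coeff_freqProj_of_notMem (S := Set.Ici 0) f hk).symm

theorem conjOp_freqProj_Ici (f : L2Torus) :
    conjOp (freqProj (Set.Ici 0) f) = freqProj (Set.Iic 0) (conjOp f) := by
  refine ext_coeff fun k => ?_
  rw [coeff_conjOp]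
  by_cases hk : k ≤ 0
  · rw [coeff_freqProj_of_mem _ (by simpa using hk), coeff_freqProj_of_mem _ (by simpa using hk),
      coeff_conjOp]
  · rw [coeff_freqProj_of_notMem _ (by simpa using hk),
      coeff_freqProj_of_notMem _ (by simpa using hk), map_zero]

theorem conjOp_freqProj_Iic (f : L2Torus) :
    conjOp (freqProj (Set.Iic 0) f) = freqProj (Set.Ici 0) (conjOp f) := by
  rw [← conjOp_conjOp f, ← conjOp_freqProj_Ici, conjOp_conjOp, conjOp_conjOp]

/-- If all sums of a frequency of `b` and a frequency of `f` are negative, then `b f` has only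
negative frequencies. -/
theorem mulOp_mem_freqSpace_Iio {b : C(Torus, ℂ)} {f : L2Torus} {S R : Set ℤ}
    (hb : toL2 b ∈ freqSpace S) (hf : f ∈ freqSpace R)
    (hSR : ∀ m ∈ S, ∀ k ∈ R, m + k < 0) : mulOp b f ∈ freqSpace (Set.Iio 0) := by
  intro n hn
  rw [← (hasSum_coeff_mulOp b f n).tsum_eq]
  refine (tsum_congr fun k => ?_).trans tsum_zero
  by_cases hk : k ∈ R
  · rw [hb (n - k), zero_mul]
    intro hS
    have := hSR _ hS _ hk
    simp at hn
    omega
  · rw [hf k hk, mul_zero]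

theorem inner_eq_zero_of_freqSpace {f g : L2Torus} {S R : Set ℤ} (hf : f ∈ freqSpace S)
    (hg : g ∈ freqSpace R) (h : Disjoint S R) : ⟪f, g⟫_ℂ = 0 := by
  rw [← (hasSum_inner_coeff f g).tsum_eq]
  refine (tsum_congr fun k => ?_).trans tsum_zero
  by_cases hk : k ∈ S
  · rw [hg k (Set.disjoint_left.1 h hk), mul_zero]
  · rw [hf k hk, map_zero, zero_mul]

theorem conjOp_mem_freqSpace_Iic {f : L2Torus} (hf : f ∈ freqSpace (Set.Ici 0)) :
    conjOp f ∈ freqSpace (Set.Iic 0) := by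
  rw [← freqProj_eq_self hf, conjOp_freqProj_Ici]
  exact freqProj_mem _ _

/-- On the Hardy space the form `(f, g) ↦ ⟪f, b g̅⟫` depends only on the Szegő projection of `b`. -/
theorem inner_mulOp_conjOp_congr {a b : C(Torus, ℂ)}
    (hab : freqProj (Set.Ici 0) (toL2 a) = freqProj (Set.Ici 0) (toL2 b)) {f g : L2Torus}
    (hf : f ∈ freqSpace (Set.Ici 0)) (hg : g ∈ freqSpace (Set.Ici 0)) :
    ⟪f, mulOp a (conjOp g)⟫_ℂ = ⟪f, mulOp b (conjOp g)⟫_ℂ := by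
  -- The difference `a - b` has only negative frequencies and g̅ only nonpositive ones, so their
  -- product is orthogonal to the Hardy space.
  rw [← sub_eq_zero, ← inner_sub_right, ← sub_apply, ← map_sub]
  refine inner_eq_zero_of_freqSpace hf
    (mulOp_mem_freqSpace_Iio (S := Set.Iio 0) (R := Set.Iic 0) ?_ (conjOp_mem_freqSpace_Iic hg) ?_)
    ?_
  · intro k hk
    have hk : k ∈ Set.Ici (0 : ℤ) := by simpa using hk
    rw [map_sub, coeff_sub, ← coeff_freqProj_of_mem (toL2 a) hk, hab, coeff_freqProj_of_mem _ hk,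
      sub_self]
  · intro m hm k hk
    simp at hm hk
    omega
  · rw [Set.disjoint_left]
    intro k h1 h2
    simp at h1 h2
    omega

theorem conjOp_toL2 (b : C(Torus, ℂ)) : conjOp (toL2 b) = toL2 (star b) := by
  apply Lp.ext
  filter_upwards [coeFn_conjOp (toL2 b), coeFn_toL2 b, coeFn_toL2 (star b)] with x h1 h2 h3
  rw [h1, h2, h3]
  simp

/-- If `b` is in the Hardy space, `b̅` maps negative frequencies to negative frequencies. -/
theorem freqProj_mulOp_star_sub {b : C(Torus, ℂ)} (hb : toL2 b ∈ freqSpace (Set.Ici 0))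
    (y : L2Torus) :
    freqProj (Set.Iic 0) (mulOp (star b) (y - freqProj (Set.Ici 0) y)) =
      mulOp (star b) (y - freqProj (Set.Ici 0) y) := by
  have h : mulOp (star b) (y - freqProj (Set.Ici 0) y) ∈ freqSpace (Set.Iio 0) := by
    refine mulOp_mem_freqSpace_Iio (S := Set.Iic 0) (R := Set.Iio 0) ?_ ?_ ?_
    · rw [← conjOp_toL2]
      exact conjOp_mem_freqSpace_Iic hb
    · intro k hk
      rw [coeff_sub, coeff_freqProj_of_mem _ (by simpa using hk), sub_self]
    · intro m hm k hk
      simp at hm hk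
      omega
  refine freqProj_eq_self fun k hk => h k ?_
  simp at hk ⊢
  omega

/-! ### The Lax pair -/

/-- A bounded linear nonautonomous differential equation can be solved on intervals whose length
is controlled by the bound of the generator. -/
theorem exists_hasDerivWithinAt_linear {E : Type*} [NormedAddCommGroup E] [NormedSpace ℝ E]
    [CompleteSpace E] {B : ℝ → E →L[ℝ] E} (hB : Continuous B) {K τ c : ℝ} (hτ : 0 ≤ τ)
    (hK : ∀ t ∈ Set.Icc (c - τ) (c + τ), ‖B t‖ ≤ K) (hKτ : K * τ ≤ 1 / 2) (x : E) :
    ∃ y : ℝ → E, y c = x ∧ ∀ t ∈ Set.Icc (c - τ) (c + τ),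
      HasDerivWithinAt y (B t (y t)) (Set.Icc (c - τ) (c + τ)) t := by
  have hc : c ∈ Set.Icc (c - τ) (c + τ) := ⟨by linarith, by linarith⟩
  have hK0 : 0 ≤ K := (norm_nonneg _).trans (hK c hc)
  lift K to NNReal using hK0
  -- On the ball of radius ‖x‖ + 1 about `x` the speed is at most K (2‖x‖ + 1). As Kτ ≤ 1/2, a
  -- solution moves by at most ‖x‖ + 1/2, so the admissible `τ` does not depend on `x`.
  have key : IsPicardLindelof (fun t y => B t y) (⟨c, hc⟩ : Set.Icc (c - τ) (c + τ)) x
      (‖x‖₊ + 1) 0 (K * (2 * ‖x‖₊ + 1)) K := by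
    refine ⟨fun t ht => ?_, fun y _ => ?_, fun t ht y hy => ?_, ?_⟩
    · exact ((B t).lipschitz.weaken (by exact_mod_cast hK t ht)).lipschitzOnWith
    · exact (hB.clm_apply continuous_const).continuousOn
    · have h1 : ‖y‖ ≤ 2 * ‖x‖ + 1 := by
        have h2 : ‖y - x‖ ≤ ‖x‖ + 1 := by simpa [dist_eq_norm] using hy
        have h3 := norm_add_le (y - x) x
        rw [sub_add_cancel] at h3
        linarith
      calc ‖B t y‖ ≤ ‖B t‖ * ‖y‖ := (B t).le_opNorm y
        _ ≤ K * (2 * ‖x‖ + 1) := by gcongr; exact hK t ht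
        _ = _ := by simp
    · have : max (c + τ - c) (c - (c - τ)) = τ := by simp
      simp only [this]
      push_cast
      have hx := norm_nonneg x
      nlinarith
  exact key.exists_eq_forall_mem_Icc_hasDerivWithinAt₀

/-- Twice the self-adjoint operator `½ H_b² - T_{|b|²}` of the Lax pair. -/
def laxOp (b : C(Torus, ℂ)) : L2Torus →L[ℂ] L2Torus :=
  (freqProj (Set.Ici 0) ∘L mulOp b ∘L freqProj (Set.Iic 0) ∘L mulOp (star b) ∘L
    freqProj (Set.Ici 0)) -
  (2 : ℂ) • (freqProj (Set.Ici 0) ∘L mulOp b ∘L mulOp (star b) ∘L freqProj (Set.Ici 0))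

theorem laxOp_apply (b : C(Torus, ℂ)) (f : L2Torus) : laxOp b f =
    freqProj (Set.Ici 0) (mulOp b (freqProj (Set.Iic 0) (mulOp (star b)
      (freqProj (Set.Ici 0) f)))) -
    (2 : ℂ) • freqProj (Set.Ici 0) (mulOp b (mulOp (star b) (freqProj (Set.Ici 0) f))) := rfl

theorem continuous_laxOp : Continuous laxOp := by
  unfold laxOp
  have h : Continuous fun b : C(Torus, ℂ) => mulOp (star b) := by fun_prop
  have h' : Continuous fun b : C(Torus, ℂ) => mulOp b := by fun_prop
  have h1 : Continuous fun b : C(Torus, ℂ) => freqProj (Set.Ici 0) ∘L mulOp b ∘L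
      freqProj (Set.Iic 0) ∘L mulOp (star b) ∘L freqProj (Set.Ici 0) :=
    .clm_comp continuous_const (h'.clm_comp (.clm_comp continuous_const
      (h.clm_comp continuous_const)))
  have h2 : Continuous fun b : C(Torus, ℂ) => freqProj (Set.Ici 0) ∘L mulOp b ∘L
      mulOp (star b) ∘L freqProj (Set.Ici 0) :=
    .clm_comp continuous_const (h'.clm_comp (h.clm_comp continuous_const))
  exact h1.sub (h2.const_smul (2 : ℂ))

theorem inner_laxOp_left (b : C(Torus, ℂ)) (f g : L2Torus) :
    ⟪laxOp b f, g⟫_ℂ = ⟪f, laxOp b g⟫_ℂ := by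
  simp only [laxOp_apply, inner_sub_left, inner_sub_right, inner_smul_left, inner_smul_right,
    inner_freqProj_left, inner_mulOp_left, star_star, Complex.conj_ofNat]

theorem laxOp_mem (b : C(Torus, ℂ)) (f : L2Torus) : laxOp b f ∈ freqSpace (Set.Ici 0) :=
  Submodule.sub_mem _ (freqProj_mem _ _) (Submodule.smul_mem _ _ (freqProj_mem _ _))

/-- The commutator identity behind the Lax pair of the cubic Szegő equation. -/
theorem lax_identity {b : C(Torus, ℂ)} (hb : toL2 b ∈ freqSpace (Set.Ici 0)) {f g : L2Torus}
    (hf : f ∈ freqSpace (Set.Ici 0)) (hg : g ∈ freqSpace (Set.Ici 0)) :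
    ⟪f, laxOp b (mulOp b (conjOp g))⟫_ℂ + ⟪f, mulOp b (conjOp (laxOp b g))⟫_ℂ
      + 2 * ⟪f, mulOp (b * star b * b) (conjOp g)⟫_ℂ = 0 := by
  have h1 : ∀ z, ⟪f, freqProj (Set.Ici 0) z⟫_ℂ = ⟪f, z⟫_ℂ := fun z => by
    rw [← inner_freqProj_left, freqProj_eq_self hf]
  set y := mulOp b (conjOp g) with hy
  have h2 := freqProj_mulOp_star_sub hb y
  have h3 : conjOp (laxOp b g) = freqProj (Set.Iic 0) (mulOp (star b) (freqProj (Set.Ici 0) y))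
      - (2 : ℂ) • freqProj (Set.Iic 0) (mulOp (star b) y) := by
    rw [laxOp_apply, map_sub, conjOp_smul, freqProj_eq_self hg]
    simp only [conjOp_freqProj_Ici, conjOp_freqProj_Iic, conjOp_mulOp, star_star, hy,
      Complex.conj_ofNat]
  simp only [map_sub] at h2
  -- With y = b g̅, the whole expression reduces to twice ⟪f, b (1 - Π_{≤0}) b̅ (y - Πy)⟫, which
  -- vanishes because b̅ (y - Πy) has only negative frequencies.
  have h4 := congrArg (fun z => ⟪f, mulOp b z⟫_ℂ) h2
  simp only [map_sub, inner_sub_right] at h4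
  rw [h3, laxOp_apply, mulOp_mul, mulOp_mul, ← hy]
  simp only [inner_sub_right, inner_smul_right, map_sub, map_smul, h1]
  linear_combination (-2) * h4


/-- The generator `(i/2) H_b² - i T_{|b|²}` of the Lax pair, over the reals. -/
def laxGen (b : C(Torus, ℂ)) : L2Torus →L[ℝ] L2Torus :=
  ((Complex.I / 2) • laxOp b).restrictScalars ℝ

theorem laxGen_apply (b : C(Torus, ℂ)) (f : L2Torus) :
    laxGen b f = (Complex.I / 2) • laxOp b f := rfl

theorem continuous_laxGen : Continuous laxGen :=
  (ContinuousLinearMap.restrictScalarsL ℂ L2Torus L2Torus ℝ ℝ).continuous.comp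
    (continuous_laxOp.const_smul (Complex.I / 2))

theorem laxGen_mem (b : C(Torus, ℂ)) (f : L2Torus) : laxGen b f ∈ freqSpace (Set.Ici 0) :=
  Submodule.smul_mem _ _ (laxOp_mem b f)

theorem inner_laxGen_left (b : C(Torus, ℂ)) (f g : L2Torus) :
    ⟪laxGen b f, g⟫_ℂ = -⟪f, laxGen b g⟫_ℂ := by
  rw [laxGen_apply, laxGen_apply, inner_smul_left, inner_smul_right, inner_laxOp_left]
  simp only [map_div₀, Complex.conj_I, Complex.conj_ofNat]
  ring

/-- Skew-adjointness in the first slot and antilinearity in the second both turn i/2 into -i/2, so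
the three terms are -i/2 times those of `lax_identity`. They are the product-rule terms of the time
derivative of the form. -/
theorem laxGen_identity {b : C(Torus, ℂ)} (hb : toL2 b ∈ freqSpace (Set.Ici 0)) {f g : L2Torus}
    (hf : f ∈ freqSpace (Set.Ici 0)) (hg : g ∈ freqSpace (Set.Ici 0)) :
    ⟪f, mulOp b (conjOp (laxGen b g))⟫_ℂ +
      ⟪f, mulOp (-Complex.I • (b * star b * b)) (conjOp g)⟫_ℂ +
      ⟪laxGen b f, mulOp b (conjOp g)⟫_ℂ = 0 := by
  rw [inner_laxGen_left, laxGen_apply, laxGen_apply, conjOp_smul, map_smul, map_smul]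
  simp only [smul_apply, inner_smul_right]
  have h := lax_identity hb hf hg
  simp only [map_div₀, Complex.conj_I, Complex.conj_ofNat]
  linear_combination (-Complex.I / 2) * h

/-- A path of continuous symbols in the Hardy space, solving the cubic Szegő equation in the sense
that it is the Szegő projection of a primitive of `-i |w|² w`. -/
structure IsSymbolFlow (w v : ℝ → C(Torus, ℂ)) : Prop where
  continuous : Continuous w
  mem : ∀ t, toL2 (w t) ∈ freqSpace (Set.Ici 0)
  hasDerivAt : ∀ t, HasDerivAt v (-Complex.I • (w t * star (w t) * w t)) t
  freqProj_eq : ∀ t, freqProj (Set.Ici 0) (toL2 (v t)) = freqProj (Set.Ici 0) (toL2 (w t))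

/-! ### Invariants of the Lax flow and transport of the Hankel form -/

theorem eq_of_hasDerivWithinAt_zero {E : Type*} [NormedAddCommGroup E] [NormedSpace ℝ E]
    {f : ℝ → E} {s : Set ℝ} (hs : Convex ℝ s) (hf : ∀ t ∈ s, HasDerivWithinAt f 0 s t) {a b : ℝ}
    (ha : a ∈ s) (hb : b ∈ s) : f a = f b := by
  have h := hs.norm_image_sub_le_of_norm_hasDerivWithin_le (C := 0) hf (by simp) hb ha
  rw [zero_mul, norm_le_zero_iff, sub_eq_zero] at h
  exact h


/-- Multiplication as a real bilinear operator. -/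
def mulOpReal : C(Torus, ℂ) →L[ℝ] L2Torus →L[ℝ] L2Torus :=
  (ContinuousLinearMap.restrictScalarsL ℂ L2Torus L2Torus ℝ ℝ) ∘L (mulOp.restrictScalars ℝ)

theorem mulOpReal_apply (b : C(Torus, ℂ)) (f : L2Torus) : mulOpReal b f = mulOp b f := rfl

/-- The generator takes its values in the Hardy space, so the component of `x` orthogonal to that
space is constant. -/
theorem mem_of_hasDerivWithinAt_laxGen {w : ℝ → C(Torus, ℂ)} {s : Set ℝ} (hs : Convex ℝ s)
    {x : ℝ → L2Torus} (hx : ∀ t ∈ s, HasDerivWithinAt x (laxGen (w t) (x t)) s t) {a c : ℝ}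
    (ha : a ∈ s) (hc : c ∈ s) (hxc : x c ∈ freqSpace (Set.Ici 0)) :
    x a ∈ freqSpace (Set.Ici 0) := by
  have h1 : ∀ t ∈ s, HasDerivWithinAt (fun t => x t - freqProj (Set.Ici 0) (x t)) 0 s t := by
    intro t ht
    have := (hx t ht).sub
      (((freqProj (Set.Ici 0)).restrictScalars ℝ).hasFDerivAt.comp_hasDerivWithinAt t (hx t ht))
    convert! this using 1
    rw [ContinuousLinearMap.coe_restrictScalars', freqProj_eq_self (laxGen_mem _ _), sub_self]
  have h2 := eq_of_hasDerivWithinAt_zero hs h1 ha hc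
  rw [freqProj_eq_self hxc, sub_self, sub_eq_zero] at h2
  rw [h2]
  exact freqProj_mem _ _

theorem inner_eq_of_hasDerivWithinAt_laxGen {w : ℝ → C(Torus, ℂ)} {s : Set ℝ} (hs : Convex ℝ s)
    {x y : ℝ → L2Torus} (hx : ∀ t ∈ s, HasDerivWithinAt x (laxGen (w t) (x t)) s t)
    (hy : ∀ t ∈ s, HasDerivWithinAt y (laxGen (w t) (y t)) s t) {a c : ℝ}
    (ha : a ∈ s) (hc : c ∈ s) : ⟪x a, y a⟫_ℂ = ⟪x c, y c⟫_ℂ := by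
  refine eq_of_hasDerivWithinAt_zero (f := fun t => ⟪x t, y t⟫_ℂ) hs (fun t ht => ?_) ha hc
  convert! (hx t ht).inner ℂ (hy t ht) using 1
  rw [inner_laxGen_left, add_neg_cancel]

/-- On the Hardy space `w` may be replaced by `v`, which is differentiable in C(𝕋); the derivative
of the form then vanishes by `laxGen_identity`. -/
theorem IsSymbolFlow.form_eq {w v : ℝ → C(Torus, ℂ)} (h : IsSymbolFlow w v) {s : Set ℝ}
    (hs : Convex ℝ s) {x y : ℝ → L2Torus}
    (hx : ∀ t ∈ s, HasDerivWithinAt x (laxGen (w t) (x t)) s t)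
    (hy : ∀ t ∈ s, HasDerivWithinAt y (laxGen (w t) (y t)) s t)
    (hxm : ∀ t ∈ s, x t ∈ freqSpace (Set.Ici 0)) (hym : ∀ t ∈ s, y t ∈ freqSpace (Set.Ici 0))
    {a c : ℝ} (ha : a ∈ s) (hc : c ∈ s) :
    ⟪x a, mulOp (w a) (conjOp (y a))⟫_ℂ = ⟪x c, mulOp (w c) (conjOp (y c))⟫_ℂ := by
  rw [← inner_mulOp_conjOp_congr (h.freqProj_eq a) (hxm a ha) (hym a ha),
    ← inner_mulOp_conjOp_congr (h.freqProj_eq c) (hxm c hc) (hym c hc)]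
  refine eq_of_hasDerivWithinAt_zero (f := fun t => ⟪x t, mulOp (v t) (conjOp (y t))⟫_ℂ) hs
    (fun t ht => ?_) ha hc
  have h1 : HasDerivWithinAt (fun t => mulOpReal (v t) (conjOp (y t)))
      (mulOpReal (-Complex.I • (w t * star (w t) * w t)) (conjOp (y t)) +
        mulOpReal (v t) (conjOp (laxGen (w t) (y t)))) s t :=
    (mulOpReal.hasFDerivAt.comp_hasDerivWithinAt t (h.hasDerivAt t).hasDerivWithinAt).clm_apply
      (conjOp.hasFDerivAt.comp_hasDerivWithinAt t (hy t ht))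
  convert! (hx t ht).inner ℂ h1 using 1
  simp only [mulOpReal_apply]
  rw [inner_add_right, inner_mulOp_conjOp_congr (h.freqProj_eq t) (hxm t ht) (laxGen_mem _ _),
    inner_mulOp_conjOp_congr (h.freqProj_eq t) (laxGen_mem _ _) (hym t ht),
    ← laxGen_identity (h.mem t) (hxm t ht) (hym t ht)]
  ring

/-- The form `⟪f, w(c) g̅⟫` is unitarily equivalent on the Hardy space to the form
`⟪f, w(a) g̅⟫`: every orthonormal family has a counterpart. -/
def IsTransported (w : ℝ → C(Torus, ℂ)) (a c : ℝ) : Prop :=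
  ∀ f : ℕ → L2Torus, Orthonormal ℂ f → (∀ n, f n ∈ freqSpace (Set.Ici 0)) →
    ∃ g : ℕ → L2Torus, Orthonormal ℂ g ∧ (∀ n, g n ∈ freqSpace (Set.Ici 0)) ∧
      ∀ m n, ⟪g m, mulOp (w a) (conjOp (g n))⟫_ℂ = ⟪f m, mulOp (w c) (conjOp (f n))⟫_ℂ

theorem IsTransported.refl (w : ℝ → C(Torus, ℂ)) (a : ℝ) : IsTransported w a a :=
  fun f hf hm => ⟨f, hf, hm, fun _ _ => rfl⟩

theorem IsTransported.trans {w : ℝ → C(Torus, ℂ)} {a b c : ℝ} (h1 : IsTransported w a b)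
    (h2 : IsTransported w b c) : IsTransported w a c := by
  intro f hf hm
  obtain ⟨g, hg, hgm, hgf⟩ := h2 f hf hm
  obtain ⟨k, hk, hkm, hkg⟩ := h1 g hg hgm
  exact ⟨k, hk, hkm, fun m n => (hkg m n).trans (hgf m n)⟩

theorem IsSymbolFlow.isTransported_of_le {w v : ℝ → C(Torus, ℂ)} (h : IsSymbolFlow w v)
    {K τ a c : ℝ} (hK : ∀ t ∈ Set.Icc (c - τ) (c + τ), ‖laxGen (w t)‖ ≤ K)
    (hKτ : K * τ ≤ 1 / 2) (hac : |a - c| ≤ τ) : IsTransported w a c := by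
  have hτ : 0 ≤ τ := (abs_nonneg _).trans hac
  have hc : c ∈ Set.Icc (c - τ) (c + τ) := ⟨by linarith, by linarith⟩
  have ha : a ∈ Set.Icc (c - τ) (c + τ) := by
    rw [abs_le] at hac
    exact ⟨by linarith, by linarith⟩
  have hs : Convex ℝ (Set.Icc (c - τ) (c + τ)) := convex_Icc _ _
  intro f hf hfm
  -- Each `f n` is the datum at time `c` of a solution of the Lax flow; its counterpart is the value
  -- of that solution at time `a`.
  choose x hxc hx using fun n =>
    exists_hasDerivWithinAt_linear (continuous_laxGen.comp h.continuous) hτ hK hKτ (f n)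
  have hxm : ∀ n, ∀ t ∈ Set.Icc (c - τ) (c + τ), x n t ∈ freqSpace (Set.Ici 0) := fun n t ht =>
    mem_of_hasDerivWithinAt_laxGen hs (hx n) ht hc (by rw [hxc]; exact hfm n)
  refine ⟨fun n => x n a, ?_, fun n => hxm n a ha, fun m n => ?_⟩
  · rw [orthonormal_iff_ite] at hf ⊢
    intro m n
    rw [inner_eq_of_hasDerivWithinAt_laxGen hs (hx m) (hx n) ha hc, hxc, hxc, hf m n]
  · rw [h.form_eq hs (hx m) (hx n) (hxm m) (hxm n) ha hc, hxc, hxc]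

theorem IsSymbolFlow.isTransported {w v : ℝ → C(Torus, ℂ)} (h : IsSymbolFlow w v) (T : ℝ) :
    IsTransported w 0 T := by
  obtain ⟨K, hK⟩ := (isCompact_Icc (a := -(|T| + 1)) (b := |T| + 1)).exists_bound_of_continuousOn
    (continuous_laxGen.comp h.continuous).continuousOn
  -- N > |T| keeps the steps at most 1, so the intervals around grid points stay where `K` is a
  -- bound; N > 2|T|K makes K |T|/N ≤ 1/2.
  obtain ⟨N, hN⟩ := exists_nat_gt (max (|T|) (2 * |T| * K))
  have hN0 : (0 : ℝ) < N := (le_max_of_le_left (abs_nonneg T)).trans_lt hN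
  have hN1 : |T| / N ≤ 1 := by
    rw [div_le_one hN0]
    exact (le_max_left _ _).trans hN.le
  have hN2 : K * (|T| / N) ≤ 1 / 2 := by
    rw [mul_div_assoc', div_le_iff₀ hN0]
    linarith [(le_max_right _ _).trans hN.le]
  have key : ∀ j : ℕ, j ≤ N → IsTransported w 0 (j * (T / N)) := by
    intro j
    induction j with
    | zero => intro _; simpa using IsTransported.refl w 0
    | succ j ih =>
      intro hj
      refine (ih (by omega)).trans (h.isTransported_of_le (K := K) (τ := |T| / N) ?_ hN2 ?_)
      · intro t ht
        have h1 : |((j + 1 : ℕ) : ℝ) * (T / N)| ≤ |T| := by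
          rw [abs_mul, abs_div, Nat.abs_cast, Nat.abs_cast, mul_div_assoc', div_le_iff₀ hN0,
            mul_comm]
          exact mul_le_mul_of_nonneg_left (by exact_mod_cast hj) (abs_nonneg T)
        rw [abs_le] at h1
        exact hK t ⟨by linarith [ht.1], by linarith [ht.2]⟩
      · have : (j : ℝ) * (T / N) - ((j + 1 : ℕ) : ℝ) * (T / N) = -(T / N) := by
          push_cast; ring
        rw [this, abs_neg, abs_div, Nat.abs_cast]
  have := key N le_rfl
  rwa [mul_div_cancel₀ _ hN0.ne'] at this

/-! ### Sobolev and Wiener norms -/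

/-- The weight `(1 + k²)^{-s/2}`. -/
def weight (s : ℝ) (k : ℤ) : ℝ := (1 + (k : ℝ) ^ 2) ^ (-s / 2)

theorem one_add_sq_pos (k : ℤ) : (0 : ℝ) < 1 + (k : ℝ) ^ 2 := by positivity

theorem weight_pos (s : ℝ) (k : ℤ) : 0 < weight s k := Real.rpow_pos_of_pos (one_add_sq_pos k) _

theorem weight_sq_mul (s : ℝ) (k : ℤ) : weight s k ^ 2 * (1 + (k : ℝ) ^ 2) ^ s = 1 := by
  rw [weight, ← Real.rpow_natCast, ← Real.rpow_mul (one_add_sq_pos k).le,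
    ← Real.rpow_add (one_add_sq_pos k)]
  have : -s / 2 * ((2 : ℕ) : ℝ) + s = 0 := by push_cast; ring
  rw [this, Real.rpow_zero]

theorem summable_weight {s : ℝ} (hs : 1 < s) : Summable (weight s) := by
  refine Summable.of_norm_bounded_eventually (Real.summable_abs_int_rpow hs) ?_
  -- The index 0 is dropped: there the real power |k|^{-s} is 0 while the weight is 1.
  filter_upwards [(Set.finite_singleton (0 : ℤ)).compl_mem_cofinite] with k hk
  have hk : 0 < |(k : ℝ)| := by simpa using hk
  rw [Real.norm_of_nonneg (weight_pos s k).le, weight]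
  have h1 : |(k : ℝ)| ^ (-s) = (|(k : ℝ)| ^ 2) ^ (-s / 2) := by
    rw [← Real.rpow_natCast, ← Real.rpow_mul hk.le]
    congr 1
    push_cast; ring
  rw [h1, sq_abs]
  exact Real.rpow_le_rpow_of_nonpos (by rw [← sq_abs]; positivity) (by linarith) (by linarith)

theorem sobolevNorm_nonneg (s : ℝ) (u : L2Torus) : 0 ≤ sobolevNorm s u := Real.sqrt_nonneg _

theorem sobolev_term_nonneg (s : ℝ) (u : L2Torus) (k : ℤ) :
    0 ≤ (1 + (k : ℝ) ^ 2) ^ s * ‖coeff u k‖ ^ 2 :=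
  mul_nonneg (Real.rpow_nonneg (one_add_sq_pos k).le _) (sq_nonneg _)

theorem sobolevNorm_sq (s : ℝ) (u : L2Torus) :
    sobolevNorm s u ^ 2 = ∑' k : ℤ, (1 + (k : ℝ) ^ 2) ^ s * ‖coeff u k‖ ^ 2 :=
  Real.sq_sqrt (tsum_nonneg (sobolev_term_nonneg s u))

theorem MemSobolev.norm_coeff_le {s : ℝ} {u : L2Torus} (hu : MemSobolev s u) (k : ℤ) :
    ‖coeff u k‖ ≤ weight s k * sobolevNorm s u := by
  refine le_of_sq_le_sq ?_ (mul_nonneg (weight_pos s k).le (sobolevNorm_nonneg s u))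
  rw [mul_pow, sobolevNorm_sq]
  calc ‖coeff u k‖ ^ 2 = weight s k ^ 2 * ((1 + (k : ℝ) ^ 2) ^ s * ‖coeff u k‖ ^ 2) := by
        rw [← mul_assoc, weight_sq_mul, one_mul]
    _ ≤ _ := by
        gcongr
        exact hu.le_tsum k fun j _ => sobolev_term_nonneg s u j

theorem MemSobolev.sub {s : ℝ} {u v : L2Torus} (hu : MemSobolev s u) (hv : MemSobolev s v) :
    MemSobolev s (u - v) := by
  refine Summable.of_nonneg_of_le (sobolev_term_nonneg s _) (fun k => ?_)
    ((Summable.add hu hv).mul_left 2)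
  have h0 : 0 ≤ (1 + (k : ℝ) ^ 2) ^ s := Real.rpow_nonneg (one_add_sq_pos k).le _
  have h1 : ‖coeff (u - v) k‖ ^ 2 ≤ 2 * (‖coeff u k‖ ^ 2 + ‖coeff v k‖ ^ 2) := by
    rw [coeff_sub]
    calc _ ≤ (‖coeff u k‖ + ‖coeff v k‖) ^ 2 := by gcongr; exact norm_sub_le _ _
      _ ≤ _ := add_sq_le
  calc _ ≤ (1 + (k : ℝ) ^ 2) ^ s * (2 * (‖coeff u k‖ ^ 2 + ‖coeff v k‖ ^ 2)) := by gcongr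
    _ = _ := by ring

theorem MemSobolev.memWiener {s : ℝ} (hs : 1 < s) {u : L2Torus} (hu : MemSobolev s u) :
    MemWiener u :=
  Summable.of_nonneg_of_le (fun _ => norm_nonneg _) hu.norm_coeff_le
    ((summable_weight hs).mul_right _)

theorem MemSobolev.wienerNorm_le {s : ℝ} (hs : 1 < s) {u : L2Torus} (hu : MemSobolev s u) :
    wienerNorm u ≤ (∑' k, weight s k) * sobolevNorm s u := by
  rw [← tsum_mul_right]
  exact (hu.memWiener hs).tsum_le_tsum hu.norm_coeff_le ((summable_weight hs).mul_right _)

/-- The continuous function with a given absolutely convergent Fourier series. -/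
def symbol (u : L2Torus) : C(Torus, ℂ) := ∑' k : ℤ, coeff u k • fourier k

theorem MemWiener.hasSum_symbol {u : L2Torus} (hu : MemWiener u) :
    HasSum (fun k : ℤ => coeff u k • (fourier k : C(Torus, ℂ))) (symbol u) := by
  refine Summable.hasSum (Summable.of_norm ?_)
  simp only [norm_smul, fourier_norm, mul_one]
  exact hu

theorem MemWiener.toL2_symbol {u : L2Torus} (hu : MemWiener u) : toL2 (symbol u) = u := by
  have h := toL2.hasSum hu.hasSum_symbol
  refine h.unique ?_
  convert! hasSum_fourier_series_L2 u using 1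

theorem norm_symbol_sub_le {u v : L2Torus} (hu : MemWiener u) (hv : MemWiener v)
    (huv : MemWiener (u - v)) : ‖symbol u - symbol v‖ ≤ wienerNorm (u - v) := by
  rw [← (hu.hasSum_symbol.sub hv.hasSum_symbol).tsum_eq]
  have h : (fun k => coeff u k • (fourier k : C(Torus, ℂ)) - coeff v k • fourier k) =
      fun k => coeff (u - v) k • (fourier k : C(Torus, ℂ)) := by
    ext1 k; rw [coeff_sub, sub_smul]
  rw [h]
  refine (norm_tsum_le_tsum_norm ?_).trans_eq ?_ <;>
    simp only [norm_smul, fourier_norm, mul_one]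
  · exact huv
  · rfl

/-- A global solution of the cubic Szegő equation gives a path of symbols. -/
theorem IsGlobalSolution.exists_isSymbolFlow {s : ℝ} (hs : 1 < s) {u₀ : L2Torus}
    {u : ℝ → L2Torus} (h : IsGlobalSolution s u₀ u) :
    ∃ w v : ℝ → C(Torus, ℂ), IsSymbolFlow w v ∧ ∀ t, toL2 (w t) = u t := by
  have hW : ∀ t, MemWiener (u t) := fun t => (h.mem t).2.memWiener hs
  have hmem : ∀ t, u t ∈ freqSpace (Set.Ici 0) := fun t k hk =>
    (h.mem t).1 k (by simpa using hk)
  have hcont : Continuous fun t => symbol (u t) := by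
    rw [continuous_iff_continuousAt]
    intro t₀
    rw [ContinuousAt, tendsto_iff_norm_sub_tendsto_zero]
    refine squeeze_zero (fun _ => norm_nonneg _) (fun t => ?_)
      (by simpa using (h.continuous t₀).const_mul (∑' k, weight s k))
    have hd := (h.mem t).2.sub (h.mem t₀).2
    exact (norm_symbol_sub_le (hW t) (hW t₀) (hd.memWiener hs)).trans (hd.wienerNorm_le hs)
  set w := fun t => symbol (u t) with hw
  have hwu : ∀ t, toL2 (w t) = u t := fun t => (hW t).toL2_symbol
  have hG : Continuous fun t => -Complex.I • (w t * star (w t) * w t) := by fun_prop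
  -- The primitive omits Π, which is not bounded on C(𝕋); the projection is applied only after
  -- passing to L².
  set v : ℝ → C(Torus, ℂ) := fun t =>
    w 0 + ∫ r in (0 : ℝ)..t, -Complex.I • (w r * star (w r) * w r) with hv
  have hvd : ∀ t, HasDerivAt v (-Complex.I • (w t * star (w t) * w t)) t := fun t =>
    ((hG.integral_hasStrictDerivAt 0 t).hasDerivAt).const_add (w 0)
  refine ⟨w, v, ⟨hcont, fun t => by rw [hwu]; exact hmem t, hvd, fun t => ?_⟩, hwu⟩
  set Q : C(Torus, ℂ) →L[ℝ] L2Torus := (freqProj (Set.Ici 0) ∘L toL2).restrictScalars ℝ with hQ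
  have hQa : ∀ b, freqProj (Set.Ici 0) (toL2 b) = Q b := fun b => rfl
  -- Πv and `u` have the same L² derivative by the equation, and they agree at time 0.
  have h0 : ∀ r ∈ Set.univ, HasDerivWithinAt (fun t => Q (v t) - u t) 0 Set.univ r := by
    intro r _
    obtain ⟨hm, u', hu', heq⟩ := h.equation r
    have h1 : hm.toLp _ = toL2 (w r * star (w r) * w r) := by
      apply Lp.ext
      have h2 := coeFn_toL2 (w r)
      rw [hwu] at h2
      filter_upwards [hm.coeFn_toLp, coeFn_toL2 (w r * star (w r) * w r), h2] with x h3 h4 h5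
      rw [h3, h4, h5]
      simp only [ContinuousMap.mul_apply, ContinuousMap.star_apply, RCLike.star_def,
        Complex.mul_conj, Complex.normSq_eq_norm_sq]
    have h2 : u' = Q (-Complex.I • (w r * star (w r) * w r)) := by
      rw [← hQa, map_smul, map_smul, ← h1, ← szegoProj_eq_freqProj, ← heq, smul_smul]
      simp
    have h3 := (Q.hasFDerivAt.comp_hasDerivAt r (hvd r)).sub hu'
    rw [← h2, sub_self] at h3
    exact h3.hasDerivWithinAt
  have h1 := eq_of_hasDerivWithinAt_zero convex_univ h0 (Set.mem_univ t) (Set.mem_univ 0)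
  have h2 : v 0 = w 0 := by simp [hv]
  simp only [h2, ← hQa, hwu, freqProj_eq_self (hmem 0), sub_self, sub_eq_zero] at h1
  rw [h1, hwu, freqProj_eq_self (hmem t)]

/-! ### The nuclear bound -/

/-- A Hankel operator maps the exponentials to a summable family. -/
theorem norm_freqProj_mulOp_conjOp_expL2_le {s : ℝ} (hs : 0 ≤ s) {b : C(Torus, ℂ)}
    (hb : MemSobolev s (toL2 b)) {k : ℤ} (hk : 0 ≤ k) :
    ‖freqProj (Set.Ici 0) (mulOp b (conjOp (expL2 k)))‖ ≤
      weight s k * sobolevNorm s (toL2 b) := by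
  refine le_of_sq_le_sq ?_ (mul_nonneg (weight_pos s k).le (sobolevNorm_nonneg s _))
  rw [mul_pow, sobolevNorm_sq, ← tsum_mul_left, ← (hasSum_norm_coeff_sq _).tsum_eq,
    ← (Equiv.addRight k).tsum_eq fun j : ℤ =>
      weight s k ^ 2 * ((1 + (j : ℝ) ^ 2) ^ s * ‖coeff (toL2 b) j‖ ^ 2)]
  refine (hasSum_norm_coeff_sq _).summable.tsum_le_tsum (fun j => ?_)
    ((Equiv.addRight k).summable_iff.2 (hb.mul_left _))
  rw [Equiv.coe_addRight]
  by_cases hj : 0 ≤ j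
  · rw [coeff_freqProj_of_mem (S := Set.Ici 0) _ hj, conjOp_expL2, coeff_mulOp_expL2,
      sub_neg_eq_add, ← mul_assoc]
    refine le_mul_of_one_le_left (sq_nonneg _) ?_
    refine (weight_sq_mul s k).symm.le.trans ?_
    -- The j-th coefficient is b̂(j + k) with j, k ≥ 0, so its Sobolev weight dominates the one at
    -- `k`.
    have : 1 + (k : ℝ) ^ 2 ≤ 1 + ((j + k : ℤ) : ℝ) ^ 2 := by
      have : 1 + k ^ 2 ≤ 1 + (j + k) ^ 2 := by nlinarith
      exact_mod_cast this
    exact mul_le_mul_of_nonneg_left (Real.rpow_le_rpow (one_add_sq_pos k).le this hs)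
      (sq_nonneg _)
  · rw [coeff_freqProj_of_notMem (S := Set.Ici 0) _ hj, norm_zero]
    have := mul_nonneg (sq_nonneg (weight s k)) (sobolev_term_nonneg s (toL2 b) (j + k))
    simpa using this

/-- This replaces the bound of the trace norm by ∑ ‖H_b e_k‖. Expanding in exponentials and using
the symmetry of the form gives the terms ⟪f_n, e_k⟫ and ⟪g_n, H_b e_k⟫; for fixed `k`,
Cauchy–Schwarz in `n` and Bessel for both families leave ‖e_k‖ ‖H_b e_k‖. -/
theorem sum_norm_inner_mulOp_conjOp_le {b : C(Torus, ℂ)} {D : ℤ → ℝ} (hD0 : ∀ k, 0 ≤ D k)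
    (hD : Summable D)
    (hbD : ∀ k, 0 ≤ k → ‖freqProj (Set.Ici 0) (mulOp b (conjOp (expL2 k)))‖ ≤ D k)
    {ι : Type*} {f g : ι → L2Torus} (hf : Orthonormal ℂ f) (hg : Orthonormal ℂ g)
    (hfm : ∀ n, f n ∈ freqSpace (Set.Ici 0)) (hgm : ∀ n, g n ∈ freqSpace (Set.Ici 0))
    (F : Finset ι) : ∑ n ∈ F, ‖⟪f n, mulOp b (conjOp (g n))⟫_ℂ‖ ≤ ∑' k, D k := by
  set t : ι → ℤ → ℝ := fun n k =>
    ‖conj (coeff (f n) k) * coeff (mulOp b (conjOp (g n))) k‖ with ht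
  have hsum : ∀ n, Summable (t n) := fun n =>
    (hasSum_inner_coeff (f n) (mulOp b (conjOp (g n)))).summable.norm
  have hle : ∀ n, ‖⟪f n, mulOp b (conjOp (g n))⟫_ℂ‖ ≤ ∑' k, t n k := fun n => by
    rw [← (hasSum_inner_coeff (f n) (mulOp b (conjOp (g n)))).tsum_eq]
    exact norm_tsum_le_tsum_norm (hsum n)
  refine (Finset.sum_le_sum fun n _ => hle n).trans ?_
  rw [← Summable.tsum_finsetSum fun n _ => hsum n]
  refine (summable_sum fun n _ => hsum n).tsum_le_tsum (fun k => ?_) hD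
  by_cases hk : 0 ≤ k
  · have h1 : ∀ n, t n k = ‖⟪f n, expL2 k⟫_ℂ‖ *
        ‖⟪g n, freqProj (Set.Ici 0) (mulOp b (conjOp (expL2 k)))⟫_ℂ‖ := fun n => by
      rw [ht]
      simp only
      rw [norm_mul, coeff_eq_inner, coeff_eq_inner, inner_conj_symm, inner_mulOp_conjOp_comm,
        ← inner_freqProj_left, freqProj_eq_self (hgm n)]
    simp only [h1]
    refine (Real.sum_mul_le_sqrt_mul_sqrt _ _ _).trans ?_
    have h2 : √(∑ n ∈ F, ‖⟪f n, expL2 k⟫_ℂ‖ ^ 2) ≤ 1 := by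
      refine Real.sqrt_le_one.2 ((hf.sum_inner_products_le _).trans_eq ?_)
      rw [orthonormal_expL2.1 k, one_pow]
    have h3 := Real.sqrt_le_sqrt (hg.sum_inner_products_le
      (freqProj (Set.Ici 0) (mulOp b (conjOp (expL2 k)))) (s := F))
    rw [Real.sqrt_sq (norm_nonneg _)] at h3
    calc _ ≤ 1 * D k := by
          gcongr
          exact h3.trans (hbD k hk)
      _ = D k := one_mul _
  · refine (Finset.sum_eq_zero fun n _ => ?_).trans_le (hD0 k)
    rw [ht]
    simp only
    rw [hfm n k hk, map_zero, zero_mul, norm_zero]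

theorem inner_expL2_mulOp_conjOp_expL2 (b : C(Torus, ℂ)) (m n : ℤ) :
    ⟪expL2 m, mulOp b (conjOp (expL2 n))⟫_ℂ = coeff (toL2 b) (m + n) := by
  rw [← coeff_eq_inner, conjOp_expL2, coeff_mulOp_expL2, sub_neg_eq_add]

theorem tsum_nat_eq_add_self_add_succ {φ : ℕ → ℝ} (h : Summable φ) :
    ∑' k, φ k = ∑' n, φ (n + n) + ∑' n, φ (n + (n + 1)) := by
  have h1 : Function.Injective fun n : ℕ => 2 * n := fun i j hij => by simpa using hij
  have h2 : Function.Injective fun n : ℕ => 2 * n + 1 := fun i j hij => by simpa using hij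
  rw [← tsum_even_add_odd (h.comp_injective h1) (h.comp_injective h2)]
  simp only [two_mul, add_assoc]

theorem tsum_int_eq_tsum_nat {φ : ℤ → ℝ} (hφ : ∀ k < 0, φ k = 0) :
    ∑' k, φ k = ∑' n : ℕ, φ n := by
  refine (Function.Injective.tsum_eq Nat.cast_injective fun k hk => ?_).symm
  by_contra hk'
  refine hk (hφ k (not_le.1 fun hk0 => hk' ?_))
  exact ⟨k.toNat, Int.toNat_of_nonneg hk0⟩

/-- If the Hankel form of `w c` is a unitary transform of the one of `w a`, the Wiener norm of
`w c` is controlled by a nuclear bound on `w a`. -/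
theorem IsTransported.wienerNorm_le {w : ℝ → C(Torus, ℂ)} {a c : ℝ} (h : IsTransported w a c)
    {D : ℤ → ℝ} (hD0 : ∀ k, 0 ≤ D k) (hD : Summable D)
    (hwD : ∀ k, 0 ≤ k → ‖freqProj (Set.Ici 0) (mulOp (w a) (conjOp (expL2 k)))‖ ≤ D k)
    (hc : toL2 (w c) ∈ freqSpace (Set.Ici 0)) (hW : MemWiener (toL2 (w c))) :
    wienerNorm (toL2 (w c)) ≤ 2 * ∑' k, D k := by
  have he : Orthonormal ℂ fun n : ℕ => expL2 n := orthonormal_expL2.comp _ Nat.cast_injective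
  obtain ⟨g, hg, hgm, hgf⟩ := h (fun n : ℕ => expL2 n) he
    fun n => expL2_mem_freqSpace (Int.natCast_nonneg n)
  have hgc : ∀ m n : ℕ, ‖coeff (toL2 (w c)) ((m + n : ℕ) : ℤ)‖ =
      ‖⟪g m, mulOp (w a) (conjOp (g n))⟫_ℂ‖ := fun m n => by
    rw [hgf, inner_expL2_mulOp_conjOp_expL2, Nat.cast_add]
  have hg1 : Orthonormal ℂ fun n => g (n + 1) := hg.comp _ (add_left_injective 1)
  have hcoeff : ∀ k < 0, ‖coeff (toL2 (w c)) k‖ = 0 := fun k hk =>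
    norm_eq_zero.2 (hc k (not_le.2 hk))
  have hsum : Summable fun n : ℕ => ‖coeff (toL2 (w c)) n‖ :=
    hW.comp_injective Nat.cast_injective
  refine ((tsum_int_eq_tsum_nat hcoeff).trans (tsum_nat_eq_add_self_add_succ hsum)).trans_le ?_
  -- Even frequencies n + n pair `g n` with itself, odd ones n + (n + 1) pair `g n` with `g (n +
  -- 1)`. Both are orthonormal families, so the nuclear bound is used twice, whence the factor 2.
  simp only [hgc]
  refine le_of_le_of_eq ?_ (two_mul _).symm
  exact add_le_add
    (Real.tsum_le_of_sum_le (fun _ => norm_nonneg _) fun F =>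
      sum_norm_inner_mulOp_conjOp_le hD0 hD hwD hg hg hgm hgm F)
    (Real.tsum_le_of_sum_le (fun _ => norm_nonneg _) fun F =>
      sum_norm_inner_mulOp_conjOp_le hD0 hD hwD hg hg1 hgm (fun n => hgm (n + 1)) F)

end CubicSzego

end

theorem proposition3 (s : ℝ) (hs : 1 < s) :
    ∃ C : ℝ, 0 < C ∧
      ∀ u₀ : CubicSzego.L2Torus, u₀ ∈ CubicSzego.sobolevPlus s →
        ∀ u : ℝ → CubicSzego.L2Torus, CubicSzego.IsGlobalSolution s u₀ u →
          ∀ t : ℝ, CubicSzego.MemWiener (u t) ∧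
            CubicSzego.wienerNorm (u t) ≤ C * CubicSzego.sobolevNorm s u₀ := by
  open CubicSzego in
  refine ⟨2 * ∑' k, weight s k, mul_pos two_pos ((summable_weight hs).tsum_pos
    (fun k => (weight_pos s k).le) 0 (weight_pos s 0)), fun u₀ hu₀ u hu t => ?_⟩
  obtain ⟨w, v, hwv, hwu⟩ := hu.exists_isSymbolFlow hs
  have hW := (hu.mem t).2.memWiener hs
  refine ⟨hW, ?_⟩
  have h0 : toL2 (w 0) = u₀ := (hwu 0).trans hu.initial
  rw [← hwu t] at hW ⊢
  rw [mul_assoc, ← tsum_mul_right]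
  refine (hwv.isTransported t).wienerNorm_le
    (fun k => mul_nonneg (weight_pos s k).le (sobolevNorm_nonneg s u₀))
    ((summable_weight hs).mul_right _) (fun k hk => ?_) (hwv.mem t) hW
  rw [← h0]
  exact norm_freqProj_mulOp_conjOp_expL2_le (by linarith) (h0 ▸ hu₀.2) hk
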